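/- Let $H=\frac1{\sqrt2}\begin{pmatrix}1&1\\1&-1\end{pmatrix}$ and, for $\phi\in\mathbb R$ (in particular for $\phi\in[0,2\pi]$), let $U_\phi=H\,\mathrm{diag}(1,e^{i\phi})\,H^\dagger$. For a $2\times2$ unitary matrix $U$ let $\mathcal P_U$ be the qubit von Neumann measurement whose effects are the projectors onto the columns of $U$, and $(\mathcal P_U\otimes 1)(\rho)=\sum_{i}|i\rangle\langle i|\otimes \mathrm{Tr}_1[(U|i\rangle\langle i|U^\dagger\otimes 1)\rho]$. To certify $\mathcal P_{1}$ (hypothesis $H_0$) against $\mathcal P_{U}$ (hypothesis $H_1$), one prepares a two-qubit unit vector $|\psi_0\rangle$, performs the unknown measurement on the first qubit and, if its outcome is $i\in\{0,1\}$, performs a von Neumann measurement $\mathcal P_{V_i}$ ($V_i$ a $2\times 2$ unitary) on the second qubit; $H_0$ is accepted if the outcome of the latter is $j=0$ and rejected if $j=1$. The type I error is the probability of $j=1$ when the unknown measurement is $\mathcal P_{1}$, and the type II error is the probability of $j=0$ when it is $\mathcal P_{U}$. Let $\delta\in[0,1]$, $c=|1+e^{i\phi}|/2$ and $$p_{\mathrm{II}}(\phi)=\begin{cases}\left(c\sqrt{1-\delta}-\sqrt{1-c^2}\,\sqrt\delta\right)^2&\text{if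 }c>\sqrt\delta,\\ 0&\text{if }c\le\sqrt\delta.\end{cases}$$ Then: 1. In the certification of $\mathcal P_{1}$ against $\mathcal P_{U_\phi}$, the minimum of the type II error over all strategies $(\psi_0,V_0,V_1)$ whose type I error is at most $\delta$ exists and equals $p_{\mathrm{II}}(\phi)$. 2. The minimum is attained with the Bell state $|\psi_0\rangle=\frac1{\sqrt2}(|00\rangle+|11\rangle)$. 3. With the Bell state as input and for each outcome $i\in\{0,1\}$ of the first measurement, the state of the second qubit conditioned on $i$ is $|i\rangle\langle i|$ under $H_0$ and $|\chi_i\rangle\langle\chi_i|$ under $H_1$, where $|\chi_i\rangle=\frac{1+e^{-i\phi}}2|i\rangle+\frac{1-e^{-i\phi}}2|i^\perp\rangle$ (in the coefficients, $i$ in $e^{-i\phi}$ is the imaginary unit), $|0^\perp\rangle=|1\rangle$ and $|1^\perp\rangle=|0\rangle$. The inner product is $\langle i|\chi_i\rangle=\frac{1+e^{-i\phi}}2$. The minimum of $\mathrm{Tr}(\Omega|\chi_i\rangle\langle\chi_i|)$ over all operators $0\le\Omega\le 1$ with $\mathrm{Tr}((1-\Omega)|i\rangle\langle i|)\le\delta$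 (the minimal type II error for certifying the state $|i\rangle$ against $|\chi_i\rangle$ at significance $\delta$) exists and also equals $p_{\mathrm{II}}(\phi)$. -/

import Mathlib

open scoped Kronecker ComplexOrder

noncomputable section

namespace QubitCertification

/-- The Hilbert space of one qubit. -/
abbrev Qubit : Type := EuclideanSpace ℂ (Fin 2)

/-- The Hilbert space of two qubits; the computational basis is indexed by pairs
(first qubit, second qubit). -/
abbrev TwoQubit : Type := EuclideanSpace ℂ (Fin 2 × Fin 2)

/-- The operator `|x⟩⟨x|`. -/
def proj {n : Type*} (x : EuclideanSpace ℂ n) : Matrix n n ℂ :=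
  Matrix.of fun a b => x a * star (x b)

/-- The computational basis vector `|i⟩`. -/
def ket (i : Fin 2) : Qubit := EuclideanSpace.single i 1

/-- The effect with label `i` of the von Neumann measurement `𝒫_U` described by the matrix `U`:
the projector onto the `i`-th column of `U`. -/
def effect (U : Matrix (Fin 2) (Fin 2) ℂ) (i : Fin 2) : Matrix (Fin 2) (Fin 2) ℂ :=
  Matrix.of fun a b => U a i * star (U b i)

/-- Partial trace over the first qubit. -/
def traceFirst (ρ : Matrix (Fin 2 × Fin 2) (Fin 2 × Fin 2) ℂ) : Matrix (Fin 2) (Fin 2) ℂ :=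
  Matrix.of fun a b => ∑ k, ρ (k, a) (k, b)

/-- `(𝒫_U ⊗ 𝟙)(ρ) = ∑ i, |i⟩⟨i| ⊗ Tr₁((E_i ⊗ 𝟙) ρ)`, where `E_i` are the effects of `𝒫_U`:
the first qubit is measured and its label is stored in the first register. -/
def measureFirst (U : Matrix (Fin 2) (Fin 2) ℂ) (ρ : Matrix (Fin 2 × Fin 2) (Fin 2 × Fin 2) ℂ) :
    Matrix (Fin 2 × Fin 2) (Fin 2 × Fin 2) ℂ :=
  ∑ i, proj (ket i) ⊗ₖ traceFirst ((effect U i ⊗ₖ (1 : Matrix (Fin 2) (Fin 2) ℂ)) * ρ)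

/-- The effect of obtaining the final outcome `j` when the label `i` is read off the first
register and `𝒫_{V i}` is then performed on the second qubit. -/
def finalEffect (V : Fin 2 → Matrix.unitaryGroup (Fin 2) ℂ) (j : Fin 2) :
    Matrix (Fin 2 × Fin 2) (Fin 2 × Fin 2) ℂ :=
  ∑ i, proj (ket i) ⊗ₖ effect (V i : Matrix (Fin 2) (Fin 2) ℂ) j

/-- Type I error of the strategy `(ψ, V₀, V₁)`: the measurement in the box is `𝒫_𝟙`
(the null hypothesis) and the final outcome is `j = 1` (reject). -/
def typeI (ψ : TwoQubit) (V : Fin 2 → Matrix.unitaryGroup (Fin 2) ℂ) : ℝ :=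
  (Matrix.trace (finalEffect V 1 * measureFirst 1 (proj ψ))).re

/-- Type II error of the strategy `(ψ, V₀, V₁)`: the measurement in the box is `𝒫_U`
(the alternative hypothesis) and the final outcome is `j = 0` (accept). -/
def typeII (U : Matrix (Fin 2) (Fin 2) ℂ) (ψ : TwoQubit)
    (V : Fin 2 → Matrix.unitaryGroup (Fin 2) ℂ) : ℝ :=
  (Matrix.trace (finalEffect V 0 * measureFirst U (proj ψ))).re

/-- All type II errors, in the certification of `𝒫_𝟙` against `𝒫_U`, of the strategies whose
type I error is at most `δ`. -/
def achievableTypeII (U : Matrix (Fin 2) (Fin 2) ℂ) (δ : ℝ) : Set ℝ :=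
  {p | ∃ (ψ : TwoQubit) (V : Fin 2 → Matrix.unitaryGroup (Fin 2) ℂ),
    ‖ψ‖ = 1 ∧ typeI ψ V ≤ δ ∧ typeII U ψ V = p}

/-- All type II errors `Tr(Ω ρ₁)`, in the certification of the state `ρ₀` against the state `ρ₁`,
of the binary measurements `{Ω, 𝟙 - Ω}` (`Ω`: accept) with type I error
`Tr((𝟙 - Ω) ρ₀)` at most `δ`. -/
def achievableTypeIIState (ρ₀ ρ₁ : Matrix (Fin 2) (Fin 2) ℂ) (δ : ℝ) : Set ℝ :=
  {p | ∃ Ω : Matrix (Fin 2) (Fin 2) ℂ, Ω.PosSemidef ∧ (1 - Ω).PosSemidef ∧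
    (Matrix.trace ((1 - Ω) * ρ₀)).re ≤ δ ∧ (Matrix.trace (Ω * ρ₁)).re = p}

/-- The state of the second qubit given the label `i` when `𝒫_U` is performed on the first qubit
of `ψ`: the block `(⟨i| ⊗ 𝟙) (𝒫_U ⊗ 𝟙)(|ψ⟩⟨ψ|) (|i⟩ ⊗ 𝟙)`, normalized to trace one. -/
def conditionalState (U : Matrix (Fin 2) (Fin 2) ℂ) (ψ : TwoQubit) (i : Fin 2) :
    Matrix (Fin 2) (Fin 2) ℂ :=
  let σ : Matrix (Fin 2) (Fin 2) ℂ :=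
    Matrix.of fun a b => measureFirst U (proj ψ) (i, a) (i, b)
  (Matrix.trace σ)⁻¹ • σ

/-- The Hadamard matrix. -/
def hadamard : Matrix (Fin 2) (Fin 2) ℂ :=
  ((1 / √2 : ℝ) : ℂ) • !![1, 1; 1, -1]

/-- The matrix `U_φ = H diag(1, exp(iφ)) H†` of the parametrized Fourier family. -/
def fourierU (φ : ℝ) : Matrix (Fin 2) (Fin 2) ℂ :=
  hadamard * Matrix.diagonal ![1, Complex.exp (φ * Complex.I)] * hadamard.conjTranspose

/-- The Bell state `(|00⟩ + |11⟩) / √2`. -/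
def bell : TwoQubit :=
  WithLp.toLp 2 fun x => if x.1 = x.2 then ((1 / √2 : ℝ) : ℂ) else 0

/-- `(1 + exp(-iφ))/2 |i⟩ + (1 - exp(-iφ))/2 |i^⊥⟩`, where `|0^⊥⟩ = |1⟩` and `|1^⊥⟩ = |0⟩`. -/
def altKet (φ : ℝ) (i : Fin 2) : Qubit :=
  ((1 + Complex.exp (-(φ * Complex.I))) / 2) • ket i +
    ((1 - Complex.exp (-(φ * Complex.I))) / 2) • ket (1 - i)

/-- The closed form, with `c = |1 + exp(iφ)| / 2`. -/
def closedForm (φ δ : ℝ) : ℝ :=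
  let c : ℝ := ‖1 + Complex.exp (φ * Complex.I)‖ / 2
  if √δ < c then (c * √(1 - δ) - √(1 - c ^ 2) * √δ) ^ 2 else 0

end QubitCertification

end

/-! The effects of a strategy are block diagonal in the label, so after dephasing the task becomes
the certification of a pure state, `ψ` against `(U† ⊗ 1) ψ`, by a binary measurement.

For pure states `x`, `y` with overlap at least `c`, splitting `1 = Ω + (1 - Ω)` and applying
Cauchy–Schwarz to each part gives `c ≤ √(1-e) √p + √e √(1-p)` for the errors `e` and `p`. The right
side is the sine of `arcsin √e + arcsin √p`, so `arcsin √p ≥ arcsin c - arcsin √δ`, which is the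
closed form (`sq_le_of_le_sqrt_mul_add`, `le_re_trace_mul_proj`).

Up to a phase, `U_φ†` is `cos (φ/2) + i sin (φ/2) X` with `X` the bit flip. Since `⟨ψ, (X ⊗ 1) ψ⟩`
is real, no input makes the overlap smaller than `|cos (φ/2)| = c`
(`abs_cos_le_norm_inner_rotateFirst`).

The Bell state loses nothing: each label has probability 1/2 and leaves the pair `|i⟩`, `χ_i`, whose
overlap is exactly `c`. An explicit qubit measurement reaches the bound for this pair
(`exists_optimal_coefficients`). -/

namespace QubitCertification

/-! ### Certification of two pure states -/

section

/-- A numerical form of the addition theorem for `sin`. -/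
lemma sq_le_of_le_sqrt_mul_add {c δ e p : ℝ} (he : 0 ≤ e) (heδ : e ≤ δ)
    (hp : 0 ≤ p) (hp1 : p ≤ 1) (hδc : √δ < c) (hc1 : c ≤ 1)
    (h : c ≤ √(1 - e) * √p + √e * √(1 - p)) :
    (c * √(1 - δ) - √(1 - c ^ 2) * √δ) ^ 2 ≤ p := by
  have hδ0 : 0 ≤ √δ := Real.sqrt_nonneg δ
  have hδ : √δ ^ 2 = δ := Real.sq_sqrt (he.trans heδ)
  have cos_eq : ∀ {t : ℝ}, 0 ≤ t → Real.cos (Real.arcsin √t) = √(1 - t) := fun ht => by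
    rw [Real.cos_arcsin, Real.sq_sqrt ht]
  have sin_eq : ∀ {t : ℝ}, t ≤ 1 → Real.sin (Real.arcsin √t) = √t := fun {t} ht =>
    Real.sin_arcsin (by linarith [Real.sqrt_nonneg t]) (Real.sqrt_le_one.2 ht)
  have hδ1 : δ ≤ 1 := by nlinarith
  set α := Real.arcsin √e with hα
  set β := Real.arcsin √p with hβ
  set γ := Real.arcsin c with hγ
  set θ := Real.arcsin √δ with hθ
  have hαθ : α ≤ θ := Real.monotone_arcsin (Real.sqrt_le_sqrt heδ)
  have hα0 : 0 ≤ α := Real.arcsin_nonneg.2 (Real.sqrt_nonneg _)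
  have hβ0 : 0 ≤ β := Real.arcsin_nonneg.2 (Real.sqrt_nonneg _)
  have hβ1 : β ≤ Real.pi / 2 := Real.arcsin_le_pi_div_two _
  have hγ1 : γ ≤ Real.pi / 2 := Real.arcsin_le_pi_div_two _
  have hθγ : θ ≤ γ := Real.monotone_arcsin hδc.le
  have hsγ : Real.sin γ = c := Real.sin_arcsin (by linarith) hc1
  have hsum : Real.sin (α + β) = √(1 - e) * √p + √e * √(1 - p) := by
    rw [Real.sin_add, sin_eq (heδ.trans hδ1), cos_eq hp, cos_eq he, sin_eq hp1]; ring
  -- Otherwise `α + β < γ ≤ π/2` because `α ≤ θ`, and strict monotonicity of the sine contradicts `c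
  -- ≤ sin (α + β)`.
  have hγβ : γ - θ ≤ β := by
    by_contra! hlt
    have := Real.sin_lt_sin_of_lt_of_le_pi_div_two (x := α + β) (y := γ)
      (by linarith [Real.pi_pos]) hγ1 (by linarith)
    linarith
  have hdiff : Real.sin (γ - θ) = c * √(1 - δ) - √(1 - c ^ 2) * √δ := by
    rw [Real.sin_sub, hsγ, cos_eq (he.trans heδ), sin_eq hδ1, hγ, Real.cos_arcsin]
  have hle : Real.sin (γ - θ) ≤ √p := by
    rw [← sin_eq hp1]
    exact Real.sin_le_sin_of_le_of_le_pi_div_two (by linarith [Real.pi_pos]) hβ1 hγβ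
  have hnn : 0 ≤ Real.sin (γ - θ) :=
    Real.sin_nonneg_of_nonneg_of_le_pi (by linarith)
      (by linarith [Real.arcsin_nonneg.2 hδ0, Real.pi_pos])
  rw [← hdiff, ← Real.sq_sqrt hp]
  gcongr

variable {n : Type*} [Fintype n]

lemma re_trace_conjTranspose_mul_self_mul_proj (B : Matrix n n ℂ)
    (x : EuclideanSpace ℂ n) :
    (Matrix.trace (B.conjTranspose * B * proj x)).re = ‖WithLp.toLp 2 (B.mulVec x)‖ ^ 2 := by
  have h : proj x = Matrix.vecMulVec (x : n → ℂ) (star (x : n → ℂ)) := rfl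
  rw [h, Matrix.mul_vecMulVec, Matrix.trace_vecMulVec, ← Matrix.mulVec_mulVec,
    ← inner_self_eq_norm_sq (𝕜 := ℂ), EuclideanSpace.inner_toLp_toLp,
    dotProduct_comm, Matrix.dotProduct_mulVec, ← Matrix.star_mulVec, dotProduct_comm]
  rfl

lemma inner_conjTranspose_mul_self_mulVec (B : Matrix n n ℂ) (x y : EuclideanSpace ℂ n) :
    inner ℂ x (WithLp.toLp 2 ((B.conjTranspose * B).mulVec y)) =
      inner ℂ (WithLp.toLp 2 (B.mulVec x)) (WithLp.toLp 2 (B.mulVec y)) := by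
  rw [EuclideanSpace.inner_toLp_toLp, ← Matrix.mulVec_mulVec, EuclideanSpace.inner_eq_star_dotProduct,
    Matrix.star_mulVec, dotProduct_comm (B.mulVec y), ← Matrix.dotProduct_mulVec, dotProduct_comm]

open scoped MatrixOrder in
lemma exists_eq_conjTranspose_mul_self {Ω : Matrix n n ℂ} (hΩ : Ω.PosSemidef) :
    ∃ B : Matrix n n ℂ, Ω = B.conjTranspose * B := by
  classical
  exact CStarAlgebra.nonneg_iff_eq_star_mul_self.1 hΩ.nonneg

variable [DecidableEq n]

/-- The lower bound on the type II error of a binary measurement `{Ω, 1 - Ω}` in the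
certification of pure states. -/
theorem le_re_trace_mul_proj {Ω : Matrix n n ℂ} (hΩ : Ω.PosSemidef) (hΩ1 : (1 - Ω).PosSemidef)
    {x y : EuclideanSpace ℂ n} (hx : ‖x‖ = 1) (hy : ‖y‖ = 1) {c δ : ℝ}
    (hδ : (Matrix.trace ((1 - Ω) * proj x)).re ≤ δ) (hc : c ≤ ‖inner ℂ x y‖) :
    (if √δ < c then (c * √(1 - δ) - √(1 - c ^ 2) * √δ) ^ 2 else 0) ≤
      (Matrix.trace (Ω * proj y)).re := by
  obtain ⟨B, hB⟩ := exists_eq_conjTranspose_mul_self hΩ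
  obtain ⟨D, hD⟩ := exists_eq_conjTranspose_mul_self hΩ1
  rw [hD, re_trace_conjTranspose_mul_self_mul_proj] at hδ
  rw [hB, re_trace_conjTranspose_mul_self_mul_proj]
  -- The identity is `B†B + D†D`, so every inner product splits into an accepting and a rejecting
  -- part.
  have key : ∀ z w : EuclideanSpace ℂ n, inner ℂ z w =
      inner ℂ (WithLp.toLp 2 (B.mulVec z)) (WithLp.toLp 2 (B.mulVec w)) +
        inner ℂ (WithLp.toLp 2 (D.mulVec z)) (WithLp.toLp 2 (D.mulVec w)) := fun z w => by
    rw [← inner_conjTranspose_mul_self_mulVec, ← inner_conjTranspose_mul_self_mulVec,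
      ← inner_add_right, ← hB, ← hD, ← WithLp.toLp_add, ← Matrix.add_mulVec, add_sub_cancel,
      Matrix.one_mulVec]
  have hsum : ∀ z : EuclideanSpace ℂ n, ‖z‖ = 1 →
      ‖WithLp.toLp 2 (B.mulVec z)‖ ^ 2 = 1 - ‖WithLp.toLp 2 (D.mulVec z)‖ ^ 2 := fun z hz => by
    have := congrArg Complex.re (key z z)
    rw [Complex.add_re] at this
    have re := inner_self_eq_norm_sq (𝕜 := ℂ) (E := EuclideanSpace ℂ n)
    simp only [RCLike.re_eq_complex_re] at re
    rw [re, re, re, hz] at this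
    linarith
  split_ifs with h
  · have hBx := hsum x hx
    have hBy := hsum y hy
    have hc1 : ‖inner ℂ x y‖ ≤ 1 := by simpa [hx, hy] using norm_inner_le_norm (𝕜 := ℂ) x y
    refine sq_le_of_le_sqrt_mul_add (sq_nonneg _) hδ (sq_nonneg _)
      (by rw [hBy]; linarith [sq_nonneg ‖WithLp.toLp 2 (D.mulVec y)‖]) h (hc.trans hc1) ?_
    rw [← hBx, hBy, sub_sub_cancel, ← hBy]
    simp only [Real.sqrt_sq (norm_nonneg _)]
    refine hc.trans ?_
    rw [key]
    exact (norm_add_le _ _).trans (add_le_add (norm_inner_le_norm _ _) (norm_inner_le_norm _ _))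
  · positivity

end

/-! ### Strategies as binary measurements of pure states -/

lemma effect_eq_vecMulVec (U : Matrix (Fin 2) (Fin 2) ℂ) (j : Fin 2) :
    effect U j = Matrix.vecMulVec (fun a => U a j) (star fun a => U a j) := rfl

lemma posSemidef_effect (U : Matrix (Fin 2) (Fin 2) ℂ) (j : Fin 2) : (effect U j).PosSemidef := by
  rw [effect_eq_vecMulVec]
  exact Matrix.posSemidef_vecMulVec_self_star _

lemma one_sub_effect_zero (V : Matrix.unitaryGroup (Fin 2) ℂ) :
    1 - effect (V : Matrix (Fin 2) (Fin 2) ℂ) 0 = effect (V : Matrix (Fin 2) (Fin 2) ℂ) 1 := by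
  have h := Matrix.mem_unitaryGroup_iff.1 V.2
  rw [sub_eq_iff_eq_add', ← h]
  ext a b
  simp [effect, Matrix.mul_apply, Fin.sum_univ_two, Matrix.star_apply]

lemma posSemidef_proj_ket (i : Fin 2) : (proj (ket i)).PosSemidef :=
  Matrix.posSemidef_vecMulVec_self_star (ket i : Fin 2 → ℂ)

lemma sum_proj_ket : ∑ i, proj (ket i) = 1 := by
  ext a b
  fin_cases a <;> fin_cases b <;> simp [proj, ket, Fin.sum_univ_two]

lemma posSemidef_finalEffect (V : Fin 2 → Matrix.unitaryGroup (Fin 2) ℂ) (j : Fin 2) :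
    (finalEffect V j).PosSemidef :=
  Matrix.posSemidef_sum _ fun i _ => (posSemidef_proj_ket i).kronecker (posSemidef_effect _ j)

lemma one_sub_finalEffect_zero (V : Fin 2 → Matrix.unitaryGroup (Fin 2) ℂ) :
    1 - finalEffect V 0 = finalEffect V 1 := by
  rw [sub_eq_iff_eq_add', finalEffect, finalEffect, ← Finset.sum_add_distrib]
  simp_rw [← Matrix.kronecker_add, ← one_sub_effect_zero, add_sub_cancel]
  rw [← Matrix.one_kronecker_one]
  nth_rewrite 1 [← sum_proj_ket]
  rw [Fin.sum_univ_two, Fin.sum_univ_two, Matrix.add_kronecker]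

/-- The vector `(U† ⊗ 1) ψ`. -/
def rotateFirst (U : Matrix (Fin 2) (Fin 2) ℂ) (ψ : TwoQubit) : TwoQubit :=
  WithLp.toLp 2 fun x => ∑ k, star (U k x.1) * ψ (k, x.2)

lemma rotateFirst_one (ψ : TwoQubit) : rotateFirst 1 ψ = ψ := by
  ext ⟨i, a⟩
  fin_cases i <;> simp [rotateFirst, Fin.sum_univ_two]

lemma measureFirst_proj_apply (U : Matrix (Fin 2) (Fin 2) ℂ) (ψ : TwoQubit) (i j a b : Fin 2) :
    measureFirst U (proj ψ) (i, a) (j, b) =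
      if i = j then rotateFirst U ψ (i, a) * star (rotateFirst U ψ (j, b)) else 0 := by
  fin_cases i <;> fin_cases j <;> fin_cases a <;> fin_cases b <;>
    simp [measureFirst, rotateFirst, Fin.sum_univ_two, proj, ket, traceFirst, effect,
      Matrix.mul_apply, Fintype.sum_prod_type, Matrix.one_apply] <;> ring

lemma finalEffect_apply (V : Fin 2 → Matrix.unitaryGroup (Fin 2) ℂ) (j i k a b : Fin 2) :
    finalEffect V j (i, a) (k, b) =
      if i = k then (V i : Matrix (Fin 2) (Fin 2) ℂ) a j *
        star ((V i : Matrix (Fin 2) (Fin 2) ℂ) b j) else 0 := by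
  fin_cases i <;> fin_cases k <;>
    simp [finalEffect, Fin.sum_univ_two, proj, ket, effect]

/-- The final effect vanishes between different labels, so it does not see the coherences that the
first measurement destroys. -/
lemma trace_finalEffect_mul_measureFirst (V : Fin 2 → Matrix.unitaryGroup (Fin 2) ℂ) (j : Fin 2)
    (U : Matrix (Fin 2) (Fin 2) ℂ) (ψ : TwoQubit) :
    Matrix.trace (finalEffect V j * measureFirst U (proj ψ)) =
      Matrix.trace (finalEffect V j * proj (rotateFirst U ψ)) := by
  simp only [Matrix.trace, Matrix.diag_apply, Matrix.mul_apply, Fintype.sum_prod_type,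
    finalEffect_apply, measureFirst_proj_apply]
  simp [proj, Fin.sum_univ_two]

lemma trace_finalEffect_mul_measureFirst_eq_sum
    (V : Fin 2 → Matrix.unitaryGroup (Fin 2) ℂ) (j : Fin 2)
    (U : Matrix (Fin 2) (Fin 2) ℂ) (ψ : TwoQubit) :
    Matrix.trace (finalEffect V j * measureFirst U (proj ψ)) =
      ∑ i, Matrix.trace (effect (V i : Matrix (Fin 2) (Fin 2) ℂ) j *
        proj (WithLp.toLp 2 fun a => rotateFirst U ψ (i, a))) := by
  simp only [Matrix.trace, Matrix.diag_apply, Matrix.mul_apply, Fintype.sum_prod_type,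
    finalEffect_apply, measureFirst_proj_apply]
  simp [proj, Fin.sum_univ_two, effect]

lemma typeI_eq (ψ : TwoQubit) (V : Fin 2 → Matrix.unitaryGroup (Fin 2) ℂ) :
    typeI ψ V = (Matrix.trace ((1 - finalEffect V 0) * proj ψ)).re := by
  rw [typeI, trace_finalEffect_mul_measureFirst, rotateFirst_one, one_sub_finalEffect_zero]

lemma typeII_eq (U : Matrix (Fin 2) (Fin 2) ℂ) (ψ : TwoQubit)
    (V : Fin 2 → Matrix.unitaryGroup (Fin 2) ℂ) :
    typeII U ψ V = (Matrix.trace (finalEffect V 0 * proj (rotateFirst U ψ))).re := by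
  rw [typeII, trace_finalEffect_mul_measureFirst]

lemma proj_smul {n : Type*} (r : ℂ) (x : EuclideanSpace ℂ n) :
    proj (r • x) = (r * star r) • proj x := by
  ext a b
  simp [proj]; ring

lemma trace_proj {n : Type*} [Fintype n] (x : EuclideanSpace ℂ n) :
    Matrix.trace (proj x) = (‖x‖ ^ 2 : ℝ) := by
  rw [EuclideanSpace.norm_sq_eq, Matrix.trace]
  push_cast
  refine Finset.sum_congr rfl fun i _ => ?_
  simpa [proj] using Complex.mul_conj' (x i)

/-- Normalization removes the factor `|r|²`, the probability of the label when `ψ` is a unit vector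
and `U` is unitary. -/
lemma conditionalState_eq_proj {U : Matrix (Fin 2) (Fin 2) ℂ} {ψ : TwoQubit} {i : Fin 2}
    {r : ℂ} {x : Qubit} (hr : r ≠ 0) (hx : ‖x‖ = 1)
    (h : ∀ a, rotateFirst U ψ (i, a) = (r • x) a) : conditionalState U ψ i = proj x := by
  have hσ : (Matrix.of fun a b => measureFirst U (proj ψ) (i, a) (i, b)) =
      (r * star r) • proj x := by
    rw [← proj_smul]
    ext a b
    rw [Matrix.of_apply, measureFirst_proj_apply, if_pos rfl, h, h]
    rfl
  have hr' : r * star r ≠ 0 := mul_ne_zero hr (star_ne_zero.2 hr)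
  simp only [conditionalState, hσ, Matrix.trace_smul, trace_proj, hx]
  rw [one_pow, Complex.ofReal_one, smul_eq_mul, mul_one, smul_smul, inv_mul_cancel₀ hr', one_smul]

/-! ### The Fourier family in terms of the half angle -/

/-- The half angle lets all entries of `U_φ` share the phase `exp (iφ/2)`, which drops out of every
norm. -/
lemma exp_eq_sq (φ : ℝ) : Complex.exp (φ * Complex.I) =
    ((Real.cos (φ / 2) : ℂ) + Real.sin (φ / 2) * Complex.I) ^ 2 := by
  rw [Complex.ofReal_cos, Complex.ofReal_sin, ← Complex.exp_mul_I, ← Complex.exp_nat_mul]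
  congr 1; push_cast; ring

lemma cos_sq_add_sin_sq_ofReal (t : ℝ) : (Real.cos t : ℂ) ^ 2 + (Real.sin t : ℂ) ^ 2 = 1 := by
  exact_mod_cast Real.cos_sq_add_sin_sq t

lemma one_add_exp_div_two (φ : ℝ) : (1 + Complex.exp (φ * Complex.I)) / 2 =
    Real.cos (φ / 2) * ((Real.cos (φ / 2) : ℂ) + Real.sin (φ / 2) * Complex.I) := by
  rw [exp_eq_sq]
  linear_combination (-1 / 2) * cos_sq_add_sin_sq_ofReal (φ / 2) +
    (Real.sin (φ / 2) : ℂ) ^ 2 / 2 * Complex.I_sq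

lemma one_sub_exp_div_two (φ : ℝ) : (1 - Complex.exp (φ * Complex.I)) / 2 =
    -(Complex.I * Real.sin (φ / 2) *
      ((Real.cos (φ / 2) : ℂ) + Real.sin (φ / 2) * Complex.I)) := by
  rw [exp_eq_sq]
  linear_combination (-1 / 2) * cos_sq_add_sin_sq_ofReal (φ / 2) +
    (Real.sin (φ / 2) : ℂ) ^ 2 / 2 * Complex.I_sq

lemma norm_cos_add_sin_mul_I (t : ℝ) :
    ‖(Real.cos t : ℂ) + Real.sin t * Complex.I‖ = 1 := by
  rw [Complex.ofReal_cos, Complex.ofReal_sin, ← Complex.exp_mul_I, Complex.norm_exp_ofReal_mul_I]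

lemma norm_one_add_exp_div_two (φ : ℝ) :
    ‖1 + Complex.exp (φ * Complex.I)‖ / 2 = |Real.cos (φ / 2)| := by
  have h := congrArg norm (one_add_exp_div_two φ)
  rw [norm_mul, norm_cos_add_sin_mul_I, mul_one, norm_div, Complex.norm_real] at h
  simpa using h

lemma exp_neg_mul_I (φ : ℝ) :
    Complex.exp (-(φ * Complex.I)) = star (Complex.exp (φ * Complex.I)) := by
  simp [← Complex.exp_conj]

lemma one_add_exp_neg_div_two (φ : ℝ) : (1 + Complex.exp (-(φ * Complex.I))) / 2 =
    Real.cos (φ / 2) * ((Real.cos (φ / 2) : ℂ) - Real.sin (φ / 2) * Complex.I) := by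
  have h := one_add_exp_div_two (-φ)
  rw [neg_div, Real.cos_neg, Real.sin_neg] at h
  push_cast at h ⊢
  rw [neg_mul] at h
  rw [h]; ring

lemma one_sub_exp_neg_div_two (φ : ℝ) : (1 - Complex.exp (-(φ * Complex.I))) / 2 =
    Complex.I * Real.sin (φ / 2) *
      ((Real.cos (φ / 2) : ℂ) - Real.sin (φ / 2) * Complex.I) := by
  have h := one_sub_exp_div_two (-φ)
  rw [neg_div, Real.cos_neg, Real.sin_neg] at h
  push_cast at h ⊢
  rw [neg_mul] at h
  rw [h]; ring

lemma fourierU_eq (φ : ℝ) : fourierU φ =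
    !![(1 + Complex.exp (φ * Complex.I)) / 2, (1 - Complex.exp (φ * Complex.I)) / 2;
      (1 - Complex.exp (φ * Complex.I)) / 2, (1 + Complex.exp (φ * Complex.I)) / 2] := by
  have h : ((√2 : ℝ) : ℂ)⁻¹ * ((√2 : ℝ) : ℂ)⁻¹ = 1 / 2 := by
    rw [← mul_inv, ← Complex.ofReal_mul, Real.mul_self_sqrt (by norm_num)]; norm_num
  ext a b
  fin_cases a <;> fin_cases b <;>
    simp [fourierU, hadamard, Matrix.mul_apply, Fin.sum_univ_two, Matrix.vecMul_diagonal]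
  · linear_combination (1 + Complex.exp (φ * Complex.I)) * h
  · linear_combination (1 - Complex.exp (φ * Complex.I)) * h
  · linear_combination (1 - Complex.exp (φ * Complex.I)) * h
  · linear_combination (1 + Complex.exp (φ * Complex.I)) * h

lemma star_fourierU_apply (φ : ℝ) (i j : Fin 2) : star (fourierU φ i j) =
    (if i = j then (Real.cos (φ / 2) : ℂ) else Complex.I * Real.sin (φ / 2)) *
      ((Real.cos (φ / 2) : ℂ) - Real.sin (φ / 2) * Complex.I) := by
  have h1 := one_add_exp_neg_div_two φ
  have h2 := one_sub_exp_neg_div_two φ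
  rw [exp_neg_mul_I] at h1 h2
  fin_cases i <;> fin_cases j
  · simpa [fourierU_eq] using h1
  · simpa [fourierU_eq] using h2
  · simpa [fourierU_eq] using h2
  · simpa [fourierU_eq] using h1

lemma norm_cos_sub_sin_mul_I (t : ℝ) :
    ‖(Real.cos t : ℂ) - Real.sin t * Complex.I‖ = 1 := by
  simpa [sub_eq_add_neg] using norm_cos_add_sin_mul_I (-t)

lemma rotateFirst_fourierU_apply (φ : ℝ) (ψ : TwoQubit) (i a : Fin 2) :
    rotateFirst (fourierU φ) ψ (i, a) =
      ((Real.cos (φ / 2) : ℂ) - Real.sin (φ / 2) * Complex.I) *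
        (Real.cos (φ / 2) * ψ (i, a) + Complex.I * Real.sin (φ / 2) * ψ (1 - i, a)) := by
  simp only [rotateFirst, star_fourierU_apply, Fin.sum_univ_two]
  fin_cases i <;> simp <;> ring

lemma norm_sq_add_norm_sq_of_rotation {C S : ℝ} (h : C ^ 2 + S ^ 2 = 1) (p q : ℂ) :
    ‖C * p + Complex.I * S * q‖ ^ 2 + ‖C * q + Complex.I * S * p‖ ^ 2 = ‖p‖ ^ 2 + ‖q‖ ^ 2 := by
  simp only [Complex.sq_norm, Complex.normSq_apply, Complex.add_re, Complex.add_im,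
    Complex.mul_re, Complex.mul_im, Complex.ofReal_re, Complex.ofReal_im, Complex.I_re,
    Complex.I_im]
  linear_combination (p.re * p.re + p.im * p.im + q.re * q.re + q.im * q.im) * h

lemma norm_rotateFirst_fourierU (φ : ℝ) {ψ : TwoQubit} (hψ : ‖ψ‖ = 1) :
    ‖rotateFirst (fourierU φ) ψ‖ = 1 := by
  have h0 := norm_sq_add_norm_sq_of_rotation (Real.cos_sq_add_sin_sq (φ / 2)) (ψ (0, 0)) (ψ (1, 0))
  have h1 := norm_sq_add_norm_sq_of_rotation (Real.cos_sq_add_sin_sq (φ / 2)) (ψ (0, 1)) (ψ (1, 1))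
  have hn : ‖ψ‖ ^ 2 = 1 := by rw [hψ, one_pow]
  rw [← sq_eq_sq₀ (norm_nonneg _) zero_le_one, one_pow, ← hn]
  simp only [EuclideanSpace.norm_sq_eq, rotateFirst_fourierU_apply, norm_mul,
    norm_cos_sub_sin_mul_I, one_mul, Fintype.sum_prod_type, Fin.sum_univ_two, sub_zero, sub_self]
  linarith

lemma abs_cos_le_norm_inner_rotateFirst (φ : ℝ) {ψ : TwoQubit} (hψ : ‖ψ‖ = 1) :
    |Real.cos (φ / 2)| ≤ ‖inner ℂ ψ (rotateFirst (fourierU φ) ψ)‖ := by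
  have hn : ‖ψ‖ ^ 2 = 1 := by rw [hψ, one_pow]
  simp only [EuclideanSpace.norm_sq_eq, Fintype.sum_prod_type, Fin.sum_univ_two, Complex.sq_norm,
    Complex.normSq_apply] at hn
  set z : ℂ := ∑ x : Fin 2 × Fin 2, star (ψ x) * (Real.cos (φ / 2) * ψ x +
    Complex.I * Real.sin (φ / 2) * ψ (1 - x.1, x.2)) with hz
  have hin : inner ℂ ψ (rotateFirst (fourierU φ) ψ) =
      ((Real.cos (φ / 2) : ℂ) - Real.sin (φ / 2) * Complex.I) * z := by
    rw [PiLp.inner_apply, hz, Finset.mul_sum]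
    refine Finset.sum_congr rfl fun x _ => ?_
    rw [← Prod.mk.eta (p := x), rotateFirst_fourierU_apply, RCLike.inner_apply]
    simp only [starRingEnd_apply]
    ring
  -- The bit flip is Hermitian, so its term in `z` is purely imaginary; the other term is `cos (φ/2)
  -- ‖ψ‖²`.
  have hre : z.re = Real.cos (φ / 2) := by
    simp only [hz, Fintype.sum_prod_type, Fin.sum_univ_two, sub_zero, sub_self, Complex.star_def,
      Complex.add_re, Complex.add_im, Complex.mul_re, Complex.mul_im, Complex.ofReal_re,
      Complex.ofReal_im, Complex.I_re, Complex.I_im, Complex.conj_re, Complex.conj_im]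
    linear_combination Real.cos (φ / 2) * hn
  rw [hin, norm_mul, norm_cos_sub_sin_mul_I, one_mul, ← hre]
  exact Complex.abs_re_le_norm z

lemma closedForm_eq (φ δ : ℝ) : closedForm φ δ =
    if √δ < |Real.cos (φ / 2)| then (|Real.cos (φ / 2)| * √(1 - δ) -
      √(1 - |Real.cos (φ / 2)| ^ 2) * √δ) ^ 2 else 0 := by
  simp only [closedForm, norm_one_add_exp_div_two]

theorem closedForm_mem_lowerBounds_achievableTypeII (φ δ : ℝ) :
    closedForm φ δ ∈ lowerBounds (achievableTypeII (fourierU φ) δ) := by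
  rintro p ⟨ψ, V, hψ, hI, rfl⟩
  rw [closedForm_eq, typeII_eq]
  rw [typeI_eq] at hI
  refine le_re_trace_mul_proj (posSemidef_finalEffect V 0) ?_ hψ (norm_rotateFirst_fourierU φ hψ)
    hI (abs_cos_le_norm_inner_rotateFirst φ hψ)
  rw [one_sub_finalEffect_zero]
  exact posSemidef_finalEffect V 1

/-! ### The Bell state -/

lemma altKet_apply (φ : ℝ) (i a : Fin 2) : altKet φ i a =
    ((Real.cos (φ / 2) : ℂ) - Real.sin (φ / 2) * Complex.I) *
      (if i = a then (Real.cos (φ / 2) : ℂ) else Complex.I * Real.sin (φ / 2)) := by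
  rw [altKet, one_add_exp_neg_div_two, one_sub_exp_neg_div_two]
  fin_cases i <;> fin_cases a <;> simp [ket] <;> ring

lemma norm_ket (i : Fin 2) : ‖ket i‖ = 1 := by simp [ket]

lemma norm_altKet (φ : ℝ) (i : Fin 2) : ‖altKet φ i‖ = 1 := by
  rw [← sq_eq_sq₀ (norm_nonneg _) zero_le_one, one_pow, ← Real.cos_sq_add_sin_sq (φ / 2)]
  simp only [EuclideanSpace.norm_sq_eq, altKet_apply, norm_mul, norm_cos_sub_sin_mul_I, one_mul,
    Fin.sum_univ_two]
  fin_cases i <;> simp [-Complex.ofReal_cos, -Complex.ofReal_sin, add_comm]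

lemma inner_ket_altKet (φ : ℝ) (i : Fin 2) :
    inner ℂ (ket i) (altKet φ i) = (1 + Complex.exp (-(φ * Complex.I))) / 2 := by
  fin_cases i <;> simp [ket, altKet, EuclideanSpace.inner_single_left]

lemma norm_inner_ket_altKet (φ : ℝ) (i : Fin 2) :
    ‖inner ℂ (ket i) (altKet φ i)‖ = |Real.cos (φ / 2)| := by
  rw [inner_ket_altKet, one_add_exp_neg_div_two, norm_mul, norm_cos_sub_sin_mul_I, mul_one,
    Complex.norm_real, Real.norm_eq_abs]

lemma bell_apply (i a : Fin 2) : bell (i, a) = (((1 / √2 : ℝ) : ℂ) • ket i) a := by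
  fin_cases i <;> fin_cases a <;> simp [bell, ket]

lemma norm_bell : ‖bell‖ = 1 := by
  rw [← sq_eq_sq₀ (norm_nonneg _) zero_le_one, EuclideanSpace.norm_sq_eq]
  simp [bell, Fintype.sum_prod_type, Fin.sum_univ_two]
  norm_num

lemma rotateFirst_fourierU_bell_apply (φ : ℝ) (i a : Fin 2) :
    rotateFirst (fourierU φ) bell (i, a) = (((1 / √2 : ℝ) : ℂ) • altKet φ i) a := by
  rw [rotateFirst_fourierU_apply, PiLp.smul_apply, altKet_apply]
  fin_cases i <;> fin_cases a <;> simp [bell] <;> ring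

lemma one_div_sqrt_two_ne_zero : ((1 / √2 : ℝ) : ℂ) ≠ 0 := by simp

lemma conditionalState_one_bell (i : Fin 2) : conditionalState 1 bell i = proj (ket i) :=
  conditionalState_eq_proj one_div_sqrt_two_ne_zero (norm_ket i) fun a => by
    rw [rotateFirst_one, bell_apply]

lemma conditionalState_fourierU_bell (φ : ℝ) (i : Fin 2) :
    conditionalState (fourierU φ) bell i = proj (altKet φ i) :=
  conditionalState_eq_proj one_div_sqrt_two_ne_zero (norm_altKet φ i)
    (rotateFirst_fourierU_bell_apply φ i)

/-- Both labels have weight 1/2, so an error of the strategy is the average of the two conditional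
errors. -/
lemma re_trace_finalEffect_mul_measureFirst {U : Matrix (Fin 2) (Fin 2) ℂ} {ψ : TwoQubit}
    {x : Fin 2 → Qubit} (h : ∀ i a, rotateFirst U ψ (i, a) = (((1 / √2 : ℝ) : ℂ) • x i) a)
    (V : Fin 2 → Matrix.unitaryGroup (Fin 2) ℂ) (j : Fin 2) :
    (Matrix.trace (finalEffect V j * measureFirst U (proj ψ))).re =
      (∑ i, (Matrix.trace (effect (V i : Matrix (Fin 2) (Fin 2) ℂ) j * proj (x i))).re) / 2 := by
  have hr : ((1 / √2 : ℝ) : ℂ) * star ((1 / √2 : ℝ) : ℂ) = ((1 / 2 : ℝ) : ℂ) := by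
    rw [Complex.star_def, Complex.conj_ofReal, ← Complex.ofReal_mul, div_mul_div_comm,
      Real.mul_self_sqrt zero_le_two, one_mul]
  have hv : ∀ i, (WithLp.toLp 2 fun a => rotateFirst U ψ (i, a)) = ((1 / √2 : ℝ) : ℂ) • x i :=
    fun i => by ext a; exact h i a
  rw [trace_finalEffect_mul_measureFirst_eq_sum, Complex.re_sum, Finset.sum_div]
  refine Finset.sum_congr rfl fun i _ => ?_
  rw [hv, proj_smul, hr, Matrix.mul_smul, Matrix.trace_smul, smul_eq_mul, Complex.re_ofReal_mul]
  ring

/-! ### Optimal measurements -/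

/-- The optimal measurement on the second qubit, given the label `i`. -/
def optimalMatrix (α β : ℝ) (i : Fin 2) : Matrix (Fin 2) (Fin 2) ℂ :=
  Matrix.of fun a j => if a = i + j then (α : ℂ) else -(Complex.I * β)

lemma optimalMatrix_mem {α β : ℝ} (h : α ^ 2 + β ^ 2 = 1) (i : Fin 2) :
    optimalMatrix α β i ∈ Matrix.unitaryGroup (Fin 2) ℂ := by
  have h' : (α : ℂ) ^ 2 + (β : ℂ) ^ 2 = 1 := by exact_mod_cast h
  rw [Matrix.mem_unitaryGroup_iff]
  ext a b
  fin_cases i <;> fin_cases a <;> fin_cases b <;>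
    simp [optimalMatrix, Matrix.mul_apply, Fin.sum_univ_two, Matrix.star_apply] <;>
    first
    | linear_combination h' - (β : ℂ) ^ 2 * Complex.I_sq
    | ring

lemma re_trace_effect_optimalMatrix_ket (α β : ℝ) (i : Fin 2) :
    (Matrix.trace (effect (optimalMatrix α β i) 1 * proj (ket i))).re = β ^ 2 := by
  fin_cases i <;>
    simp [optimalMatrix, Matrix.mul_apply, Matrix.trace, effect, proj, ket] <;>
    ring

lemma re_trace_effect_mul_proj (U : Matrix (Fin 2) (Fin 2) ℂ) (j : Fin 2) (x : Qubit) :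
    (Matrix.trace (effect U j * proj x)).re = ‖∑ a, star (U a j) * x a‖ ^ 2 := by
  rw [Complex.sq_norm, ← Complex.ofReal_re (Complex.normSq _), ← Complex.mul_conj]
  congr 1
  simp [Matrix.mul_apply, Matrix.trace, Fin.sum_univ_two, effect, proj]
  ring

/-- The accepting vector is `α |i⟩ - iβ |i^⊥⟩`. Its factor `-i` matches the `i sin (φ/2)` in `χ_i`,
so the overlap is real up to a phase. -/
lemma re_trace_effect_optimalMatrix_altKet (α β φ : ℝ) (i : Fin 2) :
    (Matrix.trace (effect (optimalMatrix α β i) 0 * proj (altKet φ i))).re =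
      (α * Real.cos (φ / 2) - β * Real.sin (φ / 2)) ^ 2 := by
  have h : ∑ a, star (optimalMatrix α β i a 0) * altKet φ i a =
      ((Real.cos (φ / 2) : ℂ) - Real.sin (φ / 2) * Complex.I) *
        ((α * Real.cos (φ / 2) - β * Real.sin (φ / 2) : ℝ) : ℂ) := by
    simp only [Fin.sum_univ_two, altKet_apply, optimalMatrix]
    push_cast
    generalize Complex.cos (φ / 2) = C
    generalize Complex.sin (φ / 2) = S
    fin_cases i <;> simp <;>
      linear_combination (C - S * Complex.I) * β * S * Complex.I_sq
  rw [re_trace_effect_mul_proj, h, norm_mul, norm_cos_sub_sin_mul_I, one_mul, Complex.norm_real,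
    Real.norm_eq_abs, sq_abs]

lemma exists_optimal_coefficients (φ : ℝ) {δ : ℝ} (hδ : δ ∈ Set.Icc (0 : ℝ) 1) :
    ∃ α β : ℝ, α ^ 2 + β ^ 2 = 1 ∧ β ^ 2 ≤ δ ∧
      (α * Real.cos (φ / 2) - β * Real.sin (φ / 2)) ^ 2 = closedForm φ δ := by
  have hCS := Real.cos_sq_add_sin_sq (φ / 2)
  rw [closedForm_eq]
  set C := Real.cos (φ / 2)
  set S := Real.sin (φ / 2)
  -- The sign `η` of `C * S` is put into `β`, so that only `|C|` and `|S|` matter.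
  obtain ⟨η, hη, hη'⟩ : ∃ η : ℝ, η ^ 2 = 1 ∧ η * (C * S) = |C| * |S| := by
    rw [← abs_mul]
    rcases le_total 0 (C * S) with h | h
    · exact ⟨1, by norm_num, by rw [abs_of_nonneg h, one_mul]⟩
    · exact ⟨-1, by norm_num, by rw [abs_of_nonpos h]; ring⟩
  have hval : ∀ α s : ℝ, (α * C - η * s * S) ^ 2 = (α * |C| - s * |S|) ^ 2 := fun α s => by
    linear_combination -2 * α * s * hη' + s ^ 2 * S ^ 2 * hη - α ^ 2 * sq_abs C - s ^ 2 * sq_abs S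
  have hS : √(1 - |C| ^ 2) = |S| := by
    rw [sq_abs, ← hCS, add_sub_cancel_left, Real.sqrt_sq_eq_abs]
  have hδ2 := Real.sq_sqrt hδ.1
  split_ifs with h
  · refine ⟨√(1 - δ), η * √δ, ?_, ?_, ?_⟩
    · rw [mul_pow, hη, hδ2, Real.sq_sqrt (sub_nonneg.2 hδ.2)]; ring
    · rw [mul_pow, hη, hδ2, one_mul]
    · rw [hval, hS]; ring
  -- When `|C| ≤ √δ`, the accepting vector can be orthogonal to `χ_i`; its type I error is `C² ≤ δ`.
  · refine ⟨|S|, η * |C|, ?_, ?_, ?_⟩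
    · rw [mul_pow, hη, sq_abs, sq_abs]; linarith
    · rw [mul_pow, hη, one_mul, ← hδ2]
      exact pow_le_pow_left₀ (abs_nonneg C) (not_lt.1 h) 2
    · rw [hval]; ring

theorem exists_optimal_measurement (φ : ℝ) {δ : ℝ} (hδ : δ ∈ Set.Icc (0 : ℝ) 1) :
    ∃ V : Fin 2 → Matrix.unitaryGroup (Fin 2) ℂ, ∀ i,
      (Matrix.trace (effect (V i : Matrix (Fin 2) (Fin 2) ℂ) 1 * proj (ket i))).re ≤ δ ∧
      (Matrix.trace (effect (V i : Matrix (Fin 2) (Fin 2) ℂ) 0 * proj (altKet φ i))).re =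
        closedForm φ δ := by
  obtain ⟨α, β, h, hβ, hp⟩ := exists_optimal_coefficients φ hδ
  refine ⟨fun i => ⟨optimalMatrix α β i, optimalMatrix_mem h i⟩, fun i => ⟨?_, ?_⟩⟩
  · rwa [re_trace_effect_optimalMatrix_ket]
  · rw [re_trace_effect_optimalMatrix_altKet, hp]

theorem exists_typeII_bell_eq_closedForm (φ : ℝ) {δ : ℝ} (hδ : δ ∈ Set.Icc (0 : ℝ) 1) :
    ∃ V : Fin 2 → Matrix.unitaryGroup (Fin 2) ℂ,
      typeI bell V ≤ δ ∧ typeII (fourierU φ) bell V = closedForm φ δ := by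
  obtain ⟨V, hV⟩ := exists_optimal_measurement φ hδ
  refine ⟨V, ?_, ?_⟩
  · rw [typeI, re_trace_finalEffect_mul_measureFirst
      (fun i a => by rw [rotateFirst_one, bell_apply]), Fin.sum_univ_two]
    linarith [(hV 0).1, (hV 1).1]
  · rw [typeII, re_trace_finalEffect_mul_measureFirst (rotateFirst_fourierU_bell_apply φ),
      Fin.sum_univ_two]
    linarith [(hV 0).2, (hV 1).2]

theorem isLeast_achievableTypeIIState (φ : ℝ) {δ : ℝ} (hδ : δ ∈ Set.Icc (0 : ℝ) 1) (i : Fin 2) :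
    IsLeast (achievableTypeIIState (proj (ket i)) (proj (altKet φ i)) δ) (closedForm φ δ) := by
  constructor
  · obtain ⟨V, hV⟩ := exists_optimal_measurement φ hδ
    refine ⟨effect (V i : Matrix (Fin 2) (Fin 2) ℂ) 0, posSemidef_effect _ _, ?_, ?_, (hV i).2⟩
    · rw [one_sub_effect_zero]
      exact posSemidef_effect _ _
    · rw [one_sub_effect_zero]
      exact (hV i).1
  · rintro p ⟨Ω, hΩ, hΩ1, hI, rfl⟩
    rw [closedForm_eq]
    exact le_re_trace_mul_proj hΩ hΩ1 (norm_ket i) (norm_altKet φ i) hI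
      (norm_inner_ket_altKet φ i).ge

end QubitCertification

theorem mainTheorem2 (φ δ : ℝ) (hδ : δ ∈ Set.Icc (0 : ℝ) 1) :
    IsLeast (QubitCertification.achievableTypeII (QubitCertification.fourierU φ) δ)
      (QubitCertification.closedForm φ δ) ∧
    (‖QubitCertification.bell‖ = 1 ∧
      ∃ V : Fin 2 → Matrix.unitaryGroup (Fin 2) ℂ,
        QubitCertification.typeI QubitCertification.bell V ≤ δ ∧
        QubitCertification.typeII (QubitCertification.fourierU φ) QubitCertification.bell V =
          QubitCertification.closedForm φ δ) ∧
    ∀ i : Fin 2,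
      QubitCertification.conditionalState 1 QubitCertification.bell i =
        QubitCertification.proj (QubitCertification.ket i) ∧
      QubitCertification.conditionalState (QubitCertification.fourierU φ)
          QubitCertification.bell i =
        QubitCertification.proj (QubitCertification.altKet φ i) ∧
      inner ℂ (QubitCertification.ket i) (QubitCertification.altKet φ i) =
        (1 + Complex.exp (-(φ * Complex.I))) / 2 ∧
      IsLeast (QubitCertification.achievableTypeIIState
          (QubitCertification.conditionalState 1 QubitCertification.bell i)
          (QubitCertification.conditionalState (QubitCertification.fourierU φ)
            QubitCertification.bell i) δ)
        (QubitCertification.closedForm φ δ) := by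
  have hbell := QubitCertification.exists_typeII_bell_eq_closedForm φ hδ
  refine ⟨⟨?_, QubitCertification.closedForm_mem_lowerBounds_achievableTypeII φ δ⟩,
    ⟨QubitCertification.norm_bell, hbell⟩, fun i => ?_⟩
  · obtain ⟨V, hI, hII⟩ := hbell
    exact ⟨QubitCertification.bell, V, QubitCertification.norm_bell, hI, hII⟩
  · rw [QubitCertification.conditionalState_one_bell,
      QubitCertification.conditionalState_fourierU_bell]
    exact ⟨rfl, rfl, QubitCertification.inner_ket_altKet φ i,
      QubitCertification.isLeast_achievableTypeIIState φ hδ i⟩
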